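/- Let $\tau\in\mathbb{C}$ with $\operatorname{Im}\tau>0$, and put $q=e^{2\pi i\tau}$ (so $0<|q|<1$) and $q^{1/2}=e^{\pi i\tau}$. Let $\eta(\tau)=e^{2\pi i\tau/24}\prod_{n=1}^{\infty}(1-q^n)$ be the Dedekind eta function, so that $\eta(k\tau)=e^{2\pi i k\tau/24}\prod_{n\ge1}(1-q^{kn})$. For $|ab|<1$ let $$f(a,b)=\sum_{j=-\infty}^{\infty}a^{j(j+1)/2}\,b^{j(j-1)/2}$$ be Ramanujan's general theta function, and let $\varphi(x)=f(x,x)$ and $\psi(x)=f(x,x^3)$ for $|x|<1$. Let $\left(\frac{m}{3}\right)$ denote the Legendre symbol modulo $3$. Then both series below converge absolutely, and: (i) $$\sum_{m=1}^{\infty}\frac{m\left(q^{m}-q^{3m}-q^{5m}+q^{7m}\right)}{1-q^{8m}}=\frac{\eta^4(8\tau)\,\eta^2(4\tau)}{\eta^2(2\tau)}\cdot\frac{\varphi(q)}{q^{1/2}\,\psi(q^4)};$$ (ii) $$\sum_{m=1}^{\infty}\left(\frac{m}{3}\right)\frac{q^{m}-q^{3m}-q^{5m}+q^{7m}}{1-q^{8m}}=\frac{\eta(\tau)\,\eta^2(2\tau)\,\eta(6\tau)\,\eta^3(8\tau)\,\eta(24\tau)}{\eta(3\tau)\,\eta^5(4\tau)}\cdot\frac{\varphi(q^2)}{q^{1/2}\,\psi(q^4)}.$$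 -/

import Mathlib

/-- Ramanujan's general theta function
`f(a, b) = ∑_{j ∈ ℤ} a^{j(j+1)/2} b^{j(j-1)/2}`, for `|a b| < 1`.
Both exponents are nonnegative integers, the integer divisions being exact. -/
noncomputable def ramanujanTheta (a b : ℂ) : ℂ :=
  ∑' j : ℤ, a ^ (j * (j + 1) / 2) * b ^ (j * (j - 1) / 2)

/-- Ramanujan's theta function `φ(q) = f(q, q)`. -/
noncomputable def ramanujanPhi (q : ℂ) : ℂ :=
  ramanujanTheta q q

/-- Ramanujan's theta function `ψ(q) = f(q, q³)`. -/
noncomputable def ramanujanPsi (q : ℂ) : ℂ :=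
  ramanujanTheta q (q ^ 3)

/-!
With base `p = q⁸`, both series have the form `∑ₘ uₘ (aᵐ + (p/a)ᵐ - bᵐ - (p/b)ᵐ) / (1 - pᵐ)` for
`a = q`, `b = q³`, where `uₘ = (cᵐ - c⁻ᵐ) / (c - c⁻¹)`: the weight `uₘ` is the Legendre symbol
`(m/3)` if `c` is a primitive cube root of unity, and tends to `m` as `c → 1`.

For `c` on the unit circle such a series is the difference of the logarithmic derivatives, at
`w = c`, of `θ(bw) θ(b/w)` and `θ(aw) θ(a/w)`, where `θ(z) = (z; p)_∞ (p/z; p)_∞`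
(`hasSum_thetaPairLogDeriv`). By the Jacobi triple product (`hasSum_tripleTerm`) and a parity
splitting of the double sum, `(p; p)_∞² θ(xy) θ(x/y) / x` is a `2 × 2` determinant in functions of
`x` and of `y` (`thetaBracket_eq`), so it satisfies the Plücker relation `thetaBracket_plucker`,
which is Weierstrass's three-term relation. Differentiating that relation turns the difference of
logarithmic derivatives into a quotient of theta functions (`thetaPairLogDeriv_sub`,
`hasSum_sineRatio_mul_lambertCoeff`); the case `c = 1` follows by dominated convergence
(`hasSum_mul_lambertCoeff`).

At `p = q⁸` these theta quotients, as well as `φ` and `ψ`, collapse to quotients of the Euler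
functions `∏ (1 - q^{kn})`, and it remains to compare powers of `e^{2πiτ/24}`.
-/

open Filter Topology

/-! ### Infinite products and Lambert series -/

/-- The infinite `q`-shifted factorial `(a; p)_∞ = ∏_{n ≥ 0} (1 - a pⁿ)`, used for `|p| < 1`. -/
noncomputable def qPoch (a p : ℂ) : ℂ := ∏' n : ℕ, (1 - a * p ^ n)

theorem summable_norm_mul_pow (a : ℂ) {p : ℂ} (hp : ‖p‖ < 1) :
    Summable fun n : ℕ => ‖-(a * p ^ n)‖ := by
  simpa using (summable_geometric_of_lt_one (norm_nonneg p) hp).mul_left ‖a‖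

theorem multipliable_qPoch (a : ℂ) {p : ℂ} (hp : ‖p‖ < 1) :
    Multipliable fun n : ℕ => 1 - a * p ^ n := by
  simpa only [sub_eq_add_neg] using multipliable_one_add_of_summable (summable_norm_mul_pow a hp)

theorem tendsto_prod_qPoch (a : ℂ) {p : ℂ} (hp : ‖p‖ < 1) :
    Tendsto (fun N => ∏ n ∈ Finset.range N, (1 - a * p ^ n)) atTop (𝓝 (qPoch a p)) :=
  (multipliable_qPoch a hp).hasProd.tendsto_prod_nat

theorem one_sub_mul_pow_ne_zero {a p : ℂ} (hp : ‖p‖ < 1) (ha : ‖a‖ < 1) (n : ℕ) :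
    1 - a * p ^ n ≠ 0 := by
  intro h
  have h1 : ‖a * p ^ n‖ < 1 := by
    rw [norm_mul, norm_pow]
    exact mul_lt_one_of_nonneg_of_lt_one_left (norm_nonneg a) ha
      (pow_le_one₀ (norm_nonneg p) hp.le)
  rw [← sub_eq_zero.mp h] at h1
  simp at h1

theorem qPoch_ne_zero {a p : ℂ} (hp : ‖p‖ < 1) (ha : ‖a‖ < 1) : qPoch a p ≠ 0 := by
  have := tprod_one_add_ne_zero_of_summable (f := fun n : ℕ => -(a * p ^ n))
    (fun n => by simpa [← sub_eq_add_neg] using one_sub_mul_pow_ne_zero hp ha n)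
    (summable_norm_mul_pow a hp)
  simpa only [qPoch, sub_eq_add_neg] using this

theorem qPoch_eq_mul_qPoch_mul (a : ℂ) {p : ℂ} (hp : ‖p‖ < 1) :
    qPoch a p = (1 - a) * qPoch (a * p) p := by
  rw [qPoch, tprod_eq_zero_mul' (by simpa [pow_succ', mul_assoc] using multipliable_qPoch (a * p) hp)]
  simp [qPoch, pow_succ', mul_assoc]

theorem norm_pow_lt_one {p : ℂ} (hp : ‖p‖ < 1) {k : ℕ} (hk : k ≠ 0) : ‖p ^ k‖ < 1 := by
  rw [norm_pow]; exact pow_lt_one₀ (norm_nonneg p) hp hk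

theorem qPoch_sq_mul (a : ℂ) {p : ℂ} (hp : ‖p‖ < 1) :
    qPoch a (p ^ 2) * qPoch (a * p) (p ^ 2) = qPoch a p := by
  have h2 := norm_pow_lt_one hp two_ne_zero
  have := tprod_even_mul_odd (f := fun n : ℕ => 1 - a * p ^ n)
    (by simpa [pow_mul] using multipliable_qPoch a h2)
    (by simpa [pow_succ', pow_mul, mul_assoc] using multipliable_qPoch (a * p) h2)
  simpa [qPoch, pow_succ', pow_mul, mul_assoc] using this

theorem qPoch_mul_qPoch_neg (a : ℂ) {p : ℂ} (hp : ‖p‖ < 1) :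
    qPoch a p * qPoch (-a) p = qPoch (a ^ 2) (p ^ 2) := by
  rw [qPoch, qPoch, ← (multipliable_qPoch a hp).tprod_mul (multipliable_qPoch (-a) hp), qPoch]
  refine tprod_congr fun n => ?_
  ring

theorem qPoch_mul_cube_roots (a : ℂ) {p ω : ℂ} (hp : ‖p‖ < 1) (hω : 1 + ω + ω ^ 2 = 0) :
    qPoch a p * qPoch (ω * a) p * qPoch (ω⁻¹ * a) p = qPoch (a ^ 3) (p ^ 3) := by
  have h3 : ω ^ 3 = 1 := by linear_combination (ω - 1) * hω
  have hinv : ω⁻¹ = ω ^ 2 := inv_eq_of_mul_eq_one_right (by rw [← h3]; ring)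
  rw [hinv, qPoch, qPoch, qPoch, qPoch,
    ← (multipliable_qPoch a hp).tprod_mul (multipliable_qPoch (ω * a) hp),
    ← ((multipliable_qPoch a hp).mul (multipliable_qPoch (ω * a) hp)).tprod_mul
      (multipliable_qPoch (ω ^ 2 * a) hp)]
  refine tprod_congr fun n => ?_
  generalize hx : p ^ n = x
  have : (p ^ 3) ^ n = x ^ 3 := by rw [← hx]; ring
  rw [this]
  linear_combination (-(a * x) + a ^ 2 * x ^ 2 * ω) * hω - a ^ 3 * x ^ 3 * h3

theorem multipliableLocallyUniformlyOn_qPoch {p : ℂ} (hp : ‖p‖ < 1) (r : ℝ) :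
    MultipliableLocallyUniformlyOn (fun (n : ℕ) (z : ℂ) => 1 - z * p ^ n) (Metric.ball 0 r) := by
  have := Summable.multipliableLocallyUniformlyOn_nat_one_add (R := ℂ)
    (f := fun (n : ℕ) (z : ℂ) => -(z * p ^ n)) (K := Metric.ball (0 : ℂ) r) Metric.isOpen_ball
    ((summable_geometric_of_lt_one (norm_nonneg p) hp).mul_left r)
    (.of_forall fun n z hz => by
      rw [norm_neg, norm_mul, norm_pow]
      gcongr
      exact (mem_ball_zero_iff.mp hz).le)
    (fun n => by fun_prop)
  simpa only [← sub_eq_add_neg] using this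

theorem differentiable_qPoch {p : ℂ} (hp : ‖p‖ < 1) : Differentiable ℂ fun z => qPoch z p := by
  intro z
  have h : DifferentiableOn ℂ (fun z => qPoch z p) (Metric.ball 0 (‖z‖ + 1)) :=
    (multipliableLocallyUniformlyOn_qPoch hp (‖z‖ + 1)).hasProdLocallyUniformlyOn.differentiableOn
      (.of_forall fun _ => by
        simpa [Finset.prod_fn] using DifferentiableOn.finsetProd (fun _ _ => by fun_prop))
      Metric.isOpen_ball
  exact h.differentiableAt (Metric.isOpen_ball.mem_nhds (by simp))

theorem continuous_qPoch {p : ℂ} (hp : ‖p‖ < 1) : Continuous fun z => qPoch z p :=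
  (differentiable_qPoch hp).continuous

/-- The Lambert series `∑_{m ≥ 1} zᵐ / (1 - pᵐ)`, which is minus the logarithmic derivative
`z d/dz` of `(z; p)_∞`. -/
noncomputable def lambertSum (z p : ℂ) : ℂ := ∑' m : ℕ, z ^ (m + 1) / (1 - p ^ (m + 1))

theorem norm_inv_one_sub_pow_le {p : ℂ} (hp : ‖p‖ < 1) (m : ℕ) :
    ‖(1 - p ^ (m + 1))⁻¹‖ ≤ (1 - ‖p‖)⁻¹ := by
  rw [norm_inv]
  have h1 : ‖p ^ (m + 1)‖ ≤ ‖p‖ := by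
    rw [norm_pow]; exact pow_le_of_le_one (norm_nonneg p) hp.le (by simp)
  have h2 := norm_sub_norm_le (1 : ℂ) (p ^ (m + 1))
  rw [norm_one] at h2
  exact inv_anti₀ (by linarith) (by linarith)

theorem summable_lambertSum {z p : ℂ} (hp : ‖p‖ < 1) (hz : ‖z‖ < 1) :
    Summable fun m : ℕ => z ^ (m + 1) / (1 - p ^ (m + 1)) := by
  have hs : Summable fun m : ℕ => ‖z‖ ^ (m + 1) * (1 - ‖p‖)⁻¹ :=
    ((summable_nat_add_iff 1).mpr
      (summable_geometric_of_lt_one (norm_nonneg z) hz)).mul_right _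
  refine hs.of_norm_bounded fun m => ?_
  rw [div_eq_mul_inv, norm_mul, norm_pow]
  gcongr
  exact norm_inv_one_sub_pow_le hp m

/-- Expand `z pⁿ / (1 - z pⁿ)` as a geometric series and sum over `n` first. -/
theorem hasSum_mul_pow_div {z p : ℂ} (hp : ‖p‖ < 1) (hz : ‖z‖ < 1) :
    HasSum (fun n : ℕ => z * p ^ n / (1 - z * p ^ n)) (lambertSum z p) := by
  have hsum : Summable fun x : ℕ × ℕ => (z * p ^ x.1) ^ (x.2 + 1) := by
    have h1 := Summable.mul_of_nonneg (summable_geometric_of_lt_one (norm_nonneg p) hp)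
      ((summable_nat_add_iff 1).mpr (summable_geometric_of_lt_one (norm_nonneg z) hz))
      (fun n => by positivity) (fun n => by positivity)
    refine h1.of_norm_bounded fun x => ?_
    rw [norm_pow, norm_mul, norm_pow, mul_pow, mul_comm, ← pow_mul]
    gcongr ?_ * _
    exact pow_le_pow_of_le_one (norm_nonneg p) hp.le (by nlinarith [x.1.zero_le])
  have hn : ∀ n : ℕ, HasSum (fun m : ℕ => (z * p ^ n) ^ (m + 1))
      (z * p ^ n / (1 - z * p ^ n)) := fun n => by
    have hlt : ‖z * p ^ n‖ < 1 := by
      rw [norm_mul, norm_pow]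
      exact mul_lt_one_of_nonneg_of_lt_one_left (norm_nonneg z) hz
        (pow_le_one₀ (norm_nonneg p) hp.le)
    simpa [pow_succ', div_eq_mul_inv] using
      (hasSum_geometric_of_norm_lt_one hlt).mul_left (z * p ^ n)
  have hm : ∀ m : ℕ, HasSum (fun n : ℕ => (z * p ^ n) ^ (m + 1))
      (z ^ (m + 1) / (1 - p ^ (m + 1))) := fun m => by
    have := (hasSum_geometric_of_norm_lt_one (norm_pow_lt_one hp m.succ_ne_zero)).mul_left
      (z ^ (m + 1))
    refine (div_eq_mul_inv (z ^ (m + 1)) _) ▸ this.congr_fun ?_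
    intro n
    simp only [Nat.succ_eq_add_one]
    ring
  have h1 := hsum.hasSum.prod_fiberwise hn
  have h2 := hsum.prod_symm.hasSum.prod_fiberwise hm
  have h3 : ∑' x : ℕ × ℕ, (z * p ^ x.swap.1) ^ (x.swap.2 + 1)
      = ∑' x : ℕ × ℕ, (z * p ^ x.1) ^ (x.2 + 1) :=
    (Equiv.prodComm ℕ ℕ).tsum_eq fun x : ℕ × ℕ => (z * p ^ x.1) ^ (x.2 + 1)
  rw [lambertSum, h2.tsum_eq]
  exact h3 ▸ h1

theorem logDeriv_qPoch {z p : ℂ} (hp : ‖p‖ < 1) (hz : ‖z‖ < 1) :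
    z * deriv (fun z => qPoch z p) z = -lambertSum z p * qPoch z p := by
  have hterm : ∀ n : ℕ, logDeriv (fun x : ℂ => 1 - x * p ^ n) z = -(p ^ n) / (1 - z * p ^ n) :=
    fun n => by simp [logDeriv_apply]
  have hsum : Summable fun n : ℕ => logDeriv (fun x : ℂ => 1 - x * p ^ n) z := by
    simp_rw [hterm]
    refine ((summable_geometric_of_lt_one (norm_nonneg p) hp).mul_right
      (1 - ‖z‖)⁻¹).of_norm_bounded fun n => ?_
    rw [div_eq_mul_inv, norm_mul, norm_neg, norm_pow, norm_inv]
    have h2 := norm_sub_norm_le (1 : ℂ) (z * p ^ n)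
    have h3 : ‖z * p ^ n‖ ≤ ‖z‖ := by
      rw [norm_mul, norm_pow]
      exact mul_le_of_le_one_right (norm_nonneg z) (pow_le_one₀ (norm_nonneg p) hp.le)
    rw [norm_one] at h2
    gcongr
    linarith
  have h := logDeriv_tprod_eq_tsum (s := Metric.ball (0 : ℂ) 1)
    (f := fun (n : ℕ) (x : ℂ) => 1 - x * p ^ n) Metric.isOpen_ball (x := z) (by simpa using hz)
    (one_sub_mul_pow_ne_zero hp hz) (fun n => by fun_prop) hsum
    (multipliableLocallyUniformlyOn_qPoch hp 1) (qPoch_ne_zero hp hz)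
  have h2 : z * ∑' n : ℕ, logDeriv (fun x : ℂ => 1 - x * p ^ n) z = -lambertSum z p := by
    rw [← tsum_mul_left, ← (hasSum_mul_pow_div hp hz).tsum_eq, ← tsum_neg]
    refine tsum_congr fun n => ?_
    rw [hterm]; ring
  rw [← h, logDeriv_apply] at h2
  have h0 := qPoch_ne_zero hp hz
  rw [← h2]
  change _ = z * (deriv (fun z => qPoch z p) z / qPoch z p) * _
  field_simp

/-! ### The Jacobi triple product identity -/

/-- The theta function `θ(z; p) = (z; p)_∞ (p / z; p)_∞` in product form. -/
noncomputable def thetaProd (p z : ℂ) : ℂ := qPoch z p * qPoch (p / z) p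

/-- The `n`-th term `(-1)ⁿ p^{n(n-1)/2} zⁿ` of the Jacobi triple product series. -/
noncomputable def tripleTerm (p z : ℂ) (n : ℤ) : ℂ := (-1) ^ n * p ^ (n * (n - 1) / 2) * z ^ n

theorem tripleTerm_ne_zero {p z : ℂ} (hp0 : p ≠ 0) (hz : z ≠ 0) (n : ℤ) :
    tripleTerm p z n ≠ 0 :=
  mul_ne_zero (mul_ne_zero (zpow_ne_zero _ (by norm_num)) (zpow_ne_zero _ hp0)) (zpow_ne_zero _ hz)

theorem tripleTerm_add_one {p z : ℂ} (hp0 : p ≠ 0) (hz : z ≠ 0) (n : ℤ) :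
    tripleTerm p z (n + 1) = -z * p ^ n * tripleTerm p z n := by
  have h : (n + 1) * (n + 1 - 1) / 2 = n * (n - 1) / 2 + n := by
    rw [show (n + 1) * (n + 1 - 1) = n * (n - 1) + n * 2 by ring]
    exact Int.add_mul_ediv_right _ _ two_ne_zero
  rw [tripleTerm, tripleTerm, h, zpow_add₀ hp0, zpow_add_one₀ hz, zpow_add_one₀ (by norm_num)]
  ring

theorem summable_norm_tripleTerm {p z : ℂ} (hp : ‖p‖ < 1) (hp0 : p ≠ 0) (hz : z ≠ 0) :
    Summable fun n : ℤ => ‖tripleTerm p z n‖ := by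
  have hne := fun n => norm_ne_zero_iff.mpr (tripleTerm_ne_zero hp0 hz n)
  have hlim := tendsto_pow_atTop_nhds_zero_of_lt_one (norm_nonneg p) hp
  refine Summable.of_nat_of_neg ?_ ?_
  · refine summable_of_ratio_test_tendsto_lt_one zero_lt_one (.of_forall fun n => hne n) ?_
    have h0 := hlim.const_mul ‖z‖
    rw [mul_zero] at h0
    refine h0.congr fun n => ?_
    have h := hne n
    push_cast
    rw [tripleTerm_add_one hp0 hz]
    simp only [norm_norm, norm_mul, norm_neg, zpow_natCast, norm_pow]
    field_simp
  · refine summable_of_ratio_test_tendsto_lt_one zero_lt_one (.of_forall fun n => hne (-n)) ?_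
    have h0 := (hlim.comp (tendsto_add_atTop_nat 1)).const_mul ‖z‖⁻¹
    rw [mul_zero] at h0
    refine h0.congr fun n => ?_
    have h := hne (-(n + 1 : ℕ))
    have h1 := tripleTerm_add_one hp0 hz (-(n + 1 : ℕ))
    rw [show -((n + 1 : ℕ) : ℤ) + 1 = -n by push_cast; ring, zpow_neg, zpow_natCast] at h1
    rw [h1]
    have hz' := norm_ne_zero_iff.mpr hz
    have hp' := norm_ne_zero_iff.mpr hp0
    simp only [norm_norm, norm_mul, norm_neg, norm_inv, norm_pow, Function.comp_apply]
    field_simp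

/-- The finite `q`-factorial `(p; p)_k`. -/
noncomputable def qFactorial (p : ℂ) (k : ℕ) : ℂ := ∏ i ∈ Finset.range k, (1 - p * p ^ i)

/-- `1 / (p; p)_A`, extended by zero to negative integers `A`. With this convention the
`q`-binomial recurrences hold without boundary cases. -/
noncomputable def invQFactorial (p : ℂ) (A : ℤ) : ℂ :=
  if A < 0 then 0 else (qFactorial p A.toNat)⁻¹

theorem qFactorial_succ (p : ℂ) (k : ℕ) :
    qFactorial p (k + 1) = qFactorial p k * (1 - p * p ^ k) := by
  rw [qFactorial, Finset.prod_range_succ, qFactorial]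

theorem qFactorial_ne_zero {p : ℂ} (hp : ‖p‖ < 1) (k : ℕ) : qFactorial p k ≠ 0 :=
  Finset.prod_ne_zero_iff.mpr fun i _ => one_sub_mul_pow_ne_zero hp hp i

theorem invQFactorial_natCast (p : ℂ) (k : ℕ) : invQFactorial p k = (qFactorial p k)⁻¹ := by
  simp [invQFactorial]

theorem invQFactorial_of_neg (p : ℂ) {A : ℤ} (hA : A < 0) : invQFactorial p A = 0 := by
  simp [invQFactorial, hA]

theorem invQFactorial_eq {p : ℂ} (hp : ‖p‖ < 1) (hp0 : p ≠ 0) (A : ℤ) :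
    invQFactorial p A = (1 - p * p ^ A) * invQFactorial p (A + 1) := by
  rcases lt_trichotomy A (-1) with h | rfl | h
  · rw [invQFactorial_of_neg p (by lia), invQFactorial_of_neg p (by lia), mul_zero]
  · rw [invQFactorial_of_neg p (by lia)]
    simp [hp0]
  · obtain ⟨k, rfl⟩ := Int.eq_ofNat_of_zero_le (by lia : 0 ≤ A)
    rw [show (k : ℤ) + 1 = (k + 1 : ℕ) by push_cast; rfl, invQFactorial_natCast,
      invQFactorial_natCast, qFactorial_succ, zpow_natCast]
    have := qFactorial_ne_zero hp k
    have := one_sub_mul_pow_ne_zero hp hp k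
    field_simp

/-- The finite form of the Jacobi triple product, by induction on the number of factors. -/
theorem hasSum_finite_triple_product {p z : ℂ} (hp : ‖p‖ < 1) (hp0 : p ≠ 0) (hz : z ≠ 0) (N : ℕ) :
    HasSum (fun n : ℤ => qFactorial p (2 * N) * tripleTerm p z n
        * invQFactorial p (N + n) * invQFactorial p (N - n))
      ((∏ k ∈ Finset.range N, (1 - z * p ^ k)) * ∏ k ∈ Finset.range N, (1 - p / z * p ^ k)) := by
  induction N with
  | zero =>
    have : HasSum (fun n : ℤ => if n = 0 then (1 : ℂ) else 0) 1 := hasSum_ite_eq 0 1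
    simp only [Finset.range_zero, Finset.prod_empty, mul_one]
    refine this.congr_fun fun n => ?_
    rcases lt_trichotomy n 0 with h | rfl | h
    · rw [invQFactorial_of_neg p (by simpa using h), if_neg h.ne]; simp
    · simp [invQFactorial, qFactorial, tripleTerm]
    · rw [invQFactorial_of_neg p (A := ((0 : ℕ) : ℤ) - n) (by simpa using h), if_neg h.ne']; simp
  | succ N ih =>
    have hm := (Equiv.subRight (1 : ℤ)).hasSum_iff.mpr ih
    have hq := (Equiv.addRight (1 : ℤ)).hasSum_iff.mpr ih
    have h := ((ih.mul_left (1 + p * p ^ (2 * N))).sub (hm.mul_left (z * p ^ N))).sub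
      (hq.mul_left (p / z * p ^ N))
    rw [Finset.prod_range_succ, Finset.prod_range_succ]
    have hval : ∀ X Y : ℂ, X * (1 - z * p ^ N) * (Y * (1 - p / z * p ^ N))
        = (1 + p * p ^ (2 * N)) * (X * Y) - z * p ^ N * (X * Y) - p / z * p ^ N * (X * Y) := by
      intro X Y
      field_simp
      ring
    rw [hval]
    refine h.congr_fun fun n => ?_
    simp only [Function.comp_apply, Equiv.subRight_apply, Equiv.coe_addRight]
    have e1 := tripleTerm_add_one hp0 hz (n - 1)
    rw [sub_add_cancel] at e1
    have e2 := tripleTerm_add_one hp0 hz n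
    set A : ℤ := N + n with hA
    set B : ℤ := N - n with hB
    have a1 : ((N + 1 : ℕ) : ℤ) + n = A + 1 := by push_cast; lia
    have a2 : ((N + 1 : ℕ) : ℤ) - n = B + 1 := by push_cast; lia
    have a3 : (N : ℤ) + (n - 1) = A - 1 := by lia
    have a4 : (N : ℤ) - (n - 1) = B + 1 := by lia
    have a5 : (N : ℤ) + (n + 1) = A + 1 := by lia
    have a6 : (N : ℤ) - (n + 1) = B - 1 := by lia
    have iA := invQFactorial_eq hp hp0 A
    have iB := invQFactorial_eq hp hp0 B
    have iA' := invQFactorial_eq hp hp0 (A - 1)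
    have iB' := invQFactorial_eq hp hp0 (B - 1)
    rw [sub_add_cancel] at iA' iB'
    have hu : p * p ^ (A - 1) = p ^ A := by rw [← zpow_one_add₀ hp0]; congr 1; ring
    have hv : p * p ^ (B - 1) = p ^ B := by rw [← zpow_one_add₀ hp0]; congr 1; ring
    rw [hu] at iA'
    rw [hv] at iB'
    have huv : p ^ (2 * N) = p ^ A * p ^ B := by
      rw [← zpow_add₀ hp0, ← zpow_natCast]; congr 1; push_cast; lia
    have hm1 : p ^ N * tripleTerm p z (n - 1) * z = -(p * p ^ B) * tripleTerm p z n := by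
      rw [e1]
      have : p * p ^ B * p ^ (n - 1) = p ^ N := by
        rw [← zpow_one_add₀ hp0, ← zpow_add₀ hp0, ← zpow_natCast]; congr 1; lia
      rw [← this]; ring
    have hp1 : p / z * p ^ N * tripleTerm p z (n + 1) = -(p * p ^ A) * tripleTerm p z n := by
      rw [e2, hA, zpow_add₀ hp0, zpow_natCast]
      field_simp
    have hF : qFactorial p (2 * (N + 1))
        = qFactorial p (2 * N) * (1 - p * (p ^ A * p ^ B)) * (1 - p ^ 2 * (p ^ A * p ^ B)) := by
      rw [show 2 * (N + 1) = 2 * N + 1 + 1 by ring, qFactorial_succ, qFactorial_succ, pow_succ,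
        huv]
      ring
    rw [a1, a2, a3, a4, a5, a6, hF, huv, iA', iB', iA, iB]
    linear_combination
      (qFactorial p (2 * N) * (1 - p ^ A) * (1 - p * p ^ A) * invQFactorial p (A + 1)
        * invQFactorial p (B + 1)) * hm1
      + qFactorial p (2 * N) * (1 - p ^ B) * (1 - p * p ^ B) * invQFactorial p (A + 1)
        * invQFactorial p (B + 1) * hp1

theorem tendsto_qFactorial {p : ℂ} (hp : ‖p‖ < 1) :
    Tendsto (qFactorial p) atTop (𝓝 (qPoch p p)) :=
  tendsto_prod_qPoch p hp

theorem tendsto_invQFactorial {p : ℂ} (hp : ‖p‖ < 1) :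
    Tendsto (invQFactorial p) atTop (𝓝 (qPoch p p)⁻¹) := by
  have h : Tendsto (fun A : ℤ => (qFactorial p A.toNat)⁻¹) atTop (𝓝 (qPoch p p)⁻¹) :=
    (((tendsto_qFactorial hp).inv₀ (qPoch_ne_zero hp hp)).comp
      (tendsto_atTop_atTop.mpr fun b => ⟨b, fun a ha => by lia⟩))
  refine h.congr' ?_
  filter_upwards [eventually_ge_atTop 0] with A hA
  simp [invQFactorial, not_lt.mpr hA]

/-- **Jacobi triple product identity**, the limit of its finite form by dominated convergence. -/
theorem hasSum_tripleTerm {p z : ℂ} (hp : ‖p‖ < 1) (hp0 : p ≠ 0) (hz : z ≠ 0) :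
    HasSum (tripleTerm p z) (qPoch p p * thetaProd p z) := by
  have hP := qPoch_ne_zero hp hp
  obtain ⟨C, hC⟩ := (Metric.isBounded_range_of_tendsto _ (tendsto_qFactorial hp)).exists_norm_le
  obtain ⟨D, hD⟩ := (Metric.isBounded_range_of_tendsto _
    ((tendsto_qFactorial hp).inv₀ hP)).exists_norm_le
  have hC' : ∀ k, ‖qFactorial p k‖ ≤ C := fun k => hC _ ⟨k, rfl⟩
  have hD' : ∀ k, ‖(qFactorial p k)⁻¹‖ ≤ D := fun k => hD _ ⟨k, rfl⟩
  have hC0 : 0 ≤ C := (norm_nonneg _).trans (hC' 0)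
  have hD0 : 0 ≤ D := (norm_nonneg _).trans (hD' 0)
  have hDA : ∀ A, ‖invQFactorial p A‖ ≤ D := fun A => by
    rw [invQFactorial]
    split_ifs
    · simpa using hD0
    · exact hD' _
  have hs := summable_norm_tripleTerm hp hp0 hz
  have hlim := tendsto_tsum_of_dominated_convergence (𝓕 := atTop)
    (f := fun (N : ℕ) (n : ℤ) => qFactorial p (2 * N) * tripleTerm p z n
        * invQFactorial p (N + n) * invQFactorial p (N - n))
    (g := fun n => qPoch p p * tripleTerm p z n * (qPoch p p)⁻¹ * (qPoch p p)⁻¹)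
    (((hs.mul_left C).mul_right D).mul_right D)
    (fun n => by
      have hN : Tendsto (fun N : ℕ => (N : ℤ)) atTop atTop := tendsto_natCast_atTop_atTop
      refine (((((tendsto_qFactorial hp).comp
        (tendsto_id.const_mul_atTop' two_pos))).mul_const _).mul
        ((tendsto_invQFactorial hp).comp (tendsto_atTop_add_const_right _ n hN))).mul
        ((tendsto_invQFactorial hp).comp ?_)
      simpa [sub_eq_add_neg] using tendsto_atTop_add_const_right _ (-n) hN)
    (.of_forall fun N n => by
      simp only [norm_mul]
      gcongr
      · exact hC' _
      · exact hDA _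
      · exact hDA _)
  have hlim2 := (tendsto_prod_qPoch z hp).mul (tendsto_prod_qPoch (p / z) hp)
  have heq := tendsto_nhds_unique (hlim.congr fun N =>
    (hasSum_finite_triple_product hp hp0 hz N).tsum_eq) hlim2
  have h2 : (fun n => qPoch p p * tripleTerm p z n * (qPoch p p)⁻¹ * (qPoch p p)⁻¹)
      = fun n => (qPoch p p)⁻¹ * tripleTerm p z n := by
    funext n; field_simp
  rw [h2, tsum_mul_left] at heq
  rw [thetaProd, ← heq, mul_inv_cancel_left₀ hP]
  exact hs.of_norm.hasSum

/-! ### The three-term relation and its derivative -/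

theorem two_mul_choose_two (n : ℤ) : 2 * (n * (n - 1) / 2) = n * (n - 1) :=
  Int.mul_ediv_cancel' (Int.even_mul_pred_self n).two_dvd

theorem tripleTerm_sq_neg (p u : ℂ) (k : ℤ) :
    tripleTerm (p ^ 2) (-u) k = p ^ (k * (k - 1)) * u ^ k := by
  have h1 : (p ^ 2) ^ (k * (k - 1) / 2) = p ^ (k * (k - 1)) := by
    rw [← zpow_natCast p 2, ← zpow_mul, Nat.cast_ofNat, two_mul_choose_two]
  have h3 : ((-1 : ℂ) ^ k) * (-1) ^ k = 1 := by rw [← mul_zpow]; simp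
  rw [tripleTerm, h1, neg_eq_neg_one_mul u, mul_zpow]
  linear_combination (p ^ (k * (k - 1)) * u ^ k) * h3

theorem tripleTerm_sq_even {p : ℂ} (hp0 : p ≠ 0) (x : ℂ) (k : ℤ) :
    tripleTerm (p ^ 2) (-(p * x ^ 2)) k = p ^ (k * k) * x ^ (2 * k) := by
  have h2 : (x ^ 2) ^ k = x ^ (2 * k) := by rw [zpow_mul]; norm_cast
  rw [tripleTerm_sq_neg, mul_zpow, h2, ← mul_assoc, ← zpow_add₀ hp0]
  congr 2
  ring

theorem tripleTerm_sq_odd {p : ℂ} (hp0 : p ≠ 0) {x : ℂ} (hx : x ≠ 0) (k : ℤ) :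
    x * tripleTerm (p ^ 2) (-(p ^ 2 * x ^ 2)) k = p ^ (k * (k + 1)) * x ^ (2 * k + 1) := by
  have h2 : (x ^ 2) ^ k = x ^ (2 * k) := by rw [zpow_mul]; norm_cast
  have h2' : (p ^ 2) ^ k = p ^ (2 * k) := by rw [zpow_mul]; norm_cast
  rw [tripleTerm_sq_neg, mul_zpow, h2, h2', zpow_add_one₀ hx,
    show k * (k + 1) = k * (k - 1) + 2 * k by ring, zpow_add₀ hp0]
  ring

/-- The sum `∑ₖ p^{k²} x^{2k}`, in product form. -/
noncomputable def evenTheta (p x : ℂ) : ℂ :=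
  qPoch (p ^ 2) (p ^ 2) * thetaProd (p ^ 2) (-(p * x ^ 2))

/-- The sum `∑ₖ p^{k(k+1)} x^{2k+1}`, in product form. -/
noncomputable def oddTheta (p x : ℂ) : ℂ :=
  x * (qPoch (p ^ 2) (p ^ 2) * thetaProd (p ^ 2) (-(p ^ 2 * x ^ 2)))

theorem tripleTerm_mul_tripleTerm {p u v : ℂ} (hp0 : p ≠ 0) (m n s : ℤ)
    (hs : m * (m - 1) + n * (n - 1) = 2 * s) :
    tripleTerm p u m * tripleTerm p v n = (-1) ^ (m + n) * p ^ s * (u ^ m * v ^ n) := by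
  have h : s = m * (m - 1) / 2 + n * (n - 1) / 2 := by
    have := two_mul_choose_two m
    have := two_mul_choose_two n
    lia
  rw [h, tripleTerm, tripleTerm, zpow_add₀ hp0, zpow_add₀ (by norm_num)]
  ring

/-- Split a sum over `ℤ × ℤ` according to the parity of the sum of the indices. -/
theorem hasSum_int_prod_of_parity {f : ℤ × ℤ → ℂ} {s t : ℂ}
    (h₀ : HasSum (fun z : ℤ × ℤ => f (z.1 + 1 + z.2, z.1 + 1 - z.2)) s)
    (h₁ : HasSum (fun z : ℤ × ℤ => f (z.1 + 1 + z.2, z.1 - z.2)) t) : HasSum f (s + t) := by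
  let i₀ : ℤ × ℤ → ℤ × ℤ := fun z => (z.1 + 1 + z.2, z.1 + 1 - z.2)
  let i₁ : ℤ × ℤ → ℤ × ℤ := fun z => (z.1 + 1 + z.2, z.1 - z.2)
  have hi₀ : Function.Injective i₀ := fun a b h => by
    have h1 := congrArg Prod.fst h
    have h2 := congrArg Prod.snd h
    simp only [i₀] at h1 h2
    ext <;> lia
  have hi₁ : Function.Injective i₁ := fun a b h => by
    have h1 := congrArg Prod.fst h
    have h2 := congrArg Prod.snd h
    simp only [i₁] at h1 h2
    ext <;> lia
  have hcompl : IsCompl (Set.range i₀) (Set.range i₁) := by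
    have h0 : Set.range i₀ = {z | Even (z.1 + z.2)} := by
      ext ⟨m, n⟩
      simp only [Set.mem_range, i₀, Set.mem_ofPred_eq, Prod.exists, Prod.mk.injEq]
      constructor
      · rintro ⟨k, l, rfl, rfl⟩; exact ⟨k + 1, by ring⟩
      · rintro ⟨k, hk⟩; exact ⟨k - 1, m - k, by lia, by lia⟩
    have h1 : Set.range i₁ = {z | Even (z.1 + z.2)}ᶜ := by
      ext ⟨m, n⟩
      simp only [Set.mem_range, i₁, Set.mem_compl_iff, Set.mem_ofPred_eq, Prod.exists,
        Prod.mk.injEq, Int.not_even_iff_odd]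
      constructor
      · rintro ⟨k, l, rfl, rfl⟩; exact ⟨k, by ring⟩
      · rintro ⟨k, hk⟩; exact ⟨k, m - k - 1, by lia, by lia⟩
    rw [h0, h1]
    exact isCompl_compl
  exact HasSum.add_isCompl hcompl (hi₀.hasSum_range_iff.mpr h₀) (hi₁.hasSum_range_iff.mpr h₁)

theorem hasSum_evenTheta {p x : ℂ} (hp : ‖p‖ < 1) (hp0 : p ≠ 0) (hx : x ≠ 0) :
    HasSum (fun k : ℤ => p ^ (k * k) * x ^ (2 * k)) (evenTheta p x) := by
  simp_rw [← tripleTerm_sq_even hp0 x]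
  exact hasSum_tripleTerm (norm_pow_lt_one hp two_ne_zero) (pow_ne_zero 2 hp0)
    (neg_ne_zero.mpr (mul_ne_zero hp0 (pow_ne_zero 2 hx)))

theorem summable_norm_evenTheta {p x : ℂ} (hp : ‖p‖ < 1) (hp0 : p ≠ 0) (hx : x ≠ 0) :
    Summable fun k : ℤ => ‖p ^ (k * k) * x ^ (2 * k)‖ := by
  simp_rw [← tripleTerm_sq_even hp0 x]
  exact summable_norm_tripleTerm (norm_pow_lt_one hp two_ne_zero) (pow_ne_zero 2 hp0)
    (neg_ne_zero.mpr (mul_ne_zero hp0 (pow_ne_zero 2 hx)))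

theorem hasSum_oddTheta {p x : ℂ} (hp : ‖p‖ < 1) (hp0 : p ≠ 0) (hx : x ≠ 0) :
    HasSum (fun k : ℤ => p ^ (k * (k + 1)) * x ^ (2 * k + 1)) (oddTheta p x) := by
  simp_rw [← tripleTerm_sq_odd hp0 hx]
  exact (hasSum_tripleTerm (norm_pow_lt_one hp two_ne_zero) (pow_ne_zero 2 hp0)
    (neg_ne_zero.mpr (mul_ne_zero (pow_ne_zero 2 hp0) (pow_ne_zero 2 hx)))).mul_left x

theorem summable_norm_oddTheta {p x : ℂ} (hp : ‖p‖ < 1) (hp0 : p ≠ 0) (hx : x ≠ 0) :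
    Summable fun k : ℤ => ‖p ^ (k * (k + 1)) * x ^ (2 * k + 1)‖ := by
  simp_rw [← tripleTerm_sq_odd hp0 hx, norm_mul x]
  exact (summable_norm_tripleTerm (norm_pow_lt_one hp two_ne_zero) (pow_ne_zero 2 hp0)
    (neg_ne_zero.mpr (mul_ne_zero (pow_ne_zero 2 hp0) (pow_ne_zero 2 hx)))).mul_left ‖x‖

theorem HasSum.mul_of_summable_norm {ι κ : Type*} {f : ι → ℂ} {g : κ → ℂ} {s t : ℂ}
    (hf : HasSum f s) (hg : HasSum g t) (hf' : Summable fun i => ‖f i‖)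
    (hg' : Summable fun i => ‖g i‖) : HasSum (fun z : ι × κ => f z.1 * g z.2) (s * t) :=
  hf.mul hg (summable_mul_of_summable_norm hf' hg')

/-- The product of two theta functions is a `2 × 2` determinant: multiply the two triple product
series and split the double sum by the parity of the sum of the indices. -/
theorem thetaProd_mul_thetaProd {p x y : ℂ} (hp : ‖p‖ < 1) (hp0 : p ≠ 0) (hx : x ≠ 0)
    (hy : y ≠ 0) :
    qPoch p p ^ 2 * thetaProd p (x * y) * thetaProd p (x / y)
      = x * (oddTheta p x * evenTheta p y - evenTheta p x * oddTheta p y) := by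
  have hxy : x * y ≠ 0 := mul_ne_zero hx hy
  have hxy' : x / y ≠ 0 := div_ne_zero hx hy
  have hfull := (hasSum_tripleTerm hp hp0 hxy).mul_of_summable_norm
    (hasSum_tripleTerm hp hp0 hxy') (summable_norm_tripleTerm hp hp0 hxy)
    (summable_norm_tripleTerm hp hp0 hxy')
  have hev := ((hasSum_oddTheta hp hp0 hx).mul_of_summable_norm (hasSum_evenTheta hp hp0 hy)
    (summable_norm_oddTheta hp hp0 hx) (summable_norm_evenTheta hp hp0 hy)).mul_left x
  have hod := ((hasSum_evenTheta hp hp0 hx).mul_of_summable_norm (hasSum_oddTheta hp hp0 hy)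
    (summable_norm_evenTheta hp hp0 hx) (summable_norm_oddTheta hp hp0 hy)).mul_left (-x)
  have hev' : HasSum (fun z : ℤ × ℤ => tripleTerm p (x * y) (z.1 + 1 + z.2)
      * tripleTerm p (x / y) (z.1 + 1 - z.2)) (x * (oddTheta p x * evenTheta p y)) := by
    refine hev.congr_fun fun ⟨k, l⟩ => ?_
    have hs : (-1 : ℂ) ^ (k + 1 + l + (k + 1 - l)) = 1 := Even.neg_one_zpow ⟨k + 1, by ring⟩
    have hxk : x ^ (k + 1 + l) * x ^ (k + 1 - l) = x * x ^ (2 * k + 1) := by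
      rw [← zpow_add₀ hx, ← zpow_one_add₀ hx]; congr 1; ring
    have hyl : y ^ (k + 1 + l) = y ^ (2 * l) * y ^ (k + 1 - l) := by
      rw [← zpow_add₀ hy]; congr 1; ring
    have hyk := zpow_ne_zero (k + 1 - l) hy
    rw [tripleTerm_mul_tripleTerm hp0 _ _ (k * (k + 1) + l * l) (by ring), hs, mul_zpow, div_zpow,
      zpow_add₀ hp0, hyl]
    field_simp
    linear_combination hxk
  have hod' : HasSum (fun z : ℤ × ℤ => tripleTerm p (x * y) (z.1 + 1 + z.2)
      * tripleTerm p (x / y) (z.1 - z.2)) (-x * (evenTheta p x * oddTheta p y)) := by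
    refine hod.congr_fun fun ⟨k, l⟩ => ?_
    have hs : (-1 : ℂ) ^ (k + 1 + l + (k - l)) = -1 := Odd.neg_one_zpow ⟨k, by ring⟩
    have hxk : x ^ (k + 1 + l) * x ^ (k - l) = x * x ^ (2 * k) := by
      rw [← zpow_add₀ hx, ← zpow_one_add₀ hx]; congr 1; ring
    have hyl : y ^ (k + 1 + l) = y ^ (2 * l + 1) * y ^ (k - l) := by
      rw [← zpow_add₀ hy]; congr 1; ring
    have hyk := zpow_ne_zero (k - l) hy
    rw [tripleTerm_mul_tripleTerm hp0 _ _ (k * k + l * (l + 1)) (by ring), hs, mul_zpow, div_zpow,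
      zpow_add₀ hp0, hyl]
    field_simp
    linear_combination -hxk
  have := hfull.unique (hasSum_int_prod_of_parity
    (f := fun z => tripleTerm p (x * y) z.1 * tripleTerm p (x / y) z.2) hev' hod')
  linear_combination this

/-- The antisymmetric function `(p; p)_∞² θ(xy) θ(x/y) / x`. -/
noncomputable def thetaBracket (p x y : ℂ) : ℂ :=
  qPoch p p ^ 2 * thetaProd p (x * y) * thetaProd p (x / y) / x

theorem thetaBracket_eq {p x y : ℂ} (hp : ‖p‖ < 1) (hp0 : p ≠ 0) (hx : x ≠ 0) (hy : y ≠ 0) :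
    thetaBracket p x y = oddTheta p x * evenTheta p y - evenTheta p x * oddTheta p y := by
  rw [thetaBracket, thetaProd_mul_thetaProd hp hp0 hx hy]
  field_simp

/-- Weierstrass's three-term relation for theta functions: since the bracket is a `2 × 2`
determinant, this is the Plücker relation. -/
theorem thetaBracket_plucker {p a b c w : ℂ} (hp : ‖p‖ < 1) (hp0 : p ≠ 0) (ha : a ≠ 0)
    (hb : b ≠ 0) (hc : c ≠ 0) (hw : w ≠ 0) :
    thetaBracket p a w * thetaBracket p b c - thetaBracket p b w * thetaBracket p a c
      = -(thetaBracket p c w * thetaBracket p a b) := by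
  rw [thetaBracket_eq hp hp0 ha hw, thetaBracket_eq hp hp0 hb hc, thetaBracket_eq hp hp0 hb hw,
    thetaBracket_eq hp hp0 ha hc, thetaBracket_eq hp hp0 hc hw, thetaBracket_eq hp hp0 ha hb]
  ring

theorem hasDerivAt_qPoch {z p : ℂ} (hp : ‖p‖ < 1) :
    HasDerivAt (fun z => qPoch z p) (deriv (fun z => qPoch z p) z) z :=
  (differentiable_qPoch hp z).hasDerivAt

theorem hasDerivAt_qPoch_mul {α c p : ℂ} (hp : ‖p‖ < 1) (hc : c ≠ 0) (h : ‖α * c‖ < 1) :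
    HasDerivAt (fun w => qPoch (α * w) p)
      (-lambertSum (α * c) p / c * qPoch (α * c) p) c := by
  have h1 := (hasDerivAt_qPoch hp (z := α * c)).comp c ((hasDerivAt_id c).const_mul α)
  refine h1.congr_deriv ?_
  have h2 := logDeriv_qPoch hp h
  field_simp
  linear_combination h2

theorem hasDerivAt_qPoch_div {β c p : ℂ} (hp : ‖p‖ < 1) (hc : c ≠ 0) (h : ‖β / c‖ < 1) :
    HasDerivAt (fun w => qPoch (β / w) p)
      (lambertSum (β / c) p / c * qPoch (β / c) p) c := by
  have h0 : HasDerivAt (fun w : ℂ => β / w) (-β / c ^ 2) c := by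
    simpa [div_eq_mul_inv] using (hasDerivAt_inv hc).const_mul β
  have h1 := (hasDerivAt_qPoch hp (z := β / c)).comp c h0
  refine h1.congr_deriv ?_
  have h2 := logDeriv_qPoch hp h
  field_simp
  field_simp at h2
  linear_combination -h2

/-- The logarithmic derivative `w d/dw` of `θ(aw) θ(a/w)` at `w = c`, as a Lambert series. -/
noncomputable def thetaPairLogDeriv (p a c : ℂ) : ℂ :=
  -lambertSum (a * c) p + lambertSum (p / a / c) p + lambertSum (a / c) p
    - lambertSum (p / a * c) p

theorem hasDerivAt_thetaBracket {p a c : ℂ} (hp : ‖p‖ < 1) (hc : c ≠ 0)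
    (h1 : ‖a * c‖ < 1) (h2 : ‖p / a / c‖ < 1) (h3 : ‖a / c‖ < 1) (h4 : ‖p / a * c‖ < 1) :
    HasDerivAt (thetaBracket p a) (thetaPairLogDeriv p a c / c * thetaBracket p a c) c := by
  have hfun : thetaBracket p a = fun w => qPoch p p ^ 2 * (qPoch (a * w) p * qPoch (p / a / w) p)
      * (qPoch (a / w) p * qPoch (p / a * w) p) / a := by
    funext w
    rw [thetaBracket, thetaProd, thetaProd, div_div_eq_mul_div, div_div, div_mul_eq_mul_div]
  rw [hfun]
  refine (((((hasDerivAt_qPoch_mul hp hc h1).mul (hasDerivAt_qPoch_div hp hc h2)).const_mul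
    (qPoch p p ^ 2)).mul ((hasDerivAt_qPoch_div hp hc h3).mul
    (hasDerivAt_qPoch_mul hp hc h4))).div_const a).congr_deriv ?_
  simp only [Pi.mul_apply, thetaPairLogDeriv]
  ring

/-- `w ↦ thetaBracket p c w` vanishes at `w = c`; its derivative there is read off from the
factor `1 - c / w` of `θ(c / w)`. -/
theorem hasDerivAt_thetaBracket_diag {p c : ℂ} (hp : ‖p‖ < 1) (hc : c ≠ 0) :
    HasDerivAt (thetaBracket p c) (qPoch p p ^ 4 * thetaProd p (c ^ 2) / c ^ 2) c := by
  have hd := differentiable_qPoch hp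
  set K : ℂ → ℂ := fun w => qPoch p p ^ 2 * (qPoch (c * w) p * qPoch (p / (c * w)) p)
    * (qPoch (c / w * p) p * qPoch (p / (c / w)) p) / c with hK
  have hfun : thetaBracket p c = fun w => (1 - c / w) * K w := by
    funext w
    rw [thetaBracket, thetaProd, thetaProd, qPoch_eq_mul_qPoch_mul (c / w) hp, hK]
    ring
  have hc2 : c * c ≠ 0 := mul_ne_zero hc hc
  have hcc : c / c ≠ 0 := div_ne_zero hc hc
  have hKd : DifferentiableAt ℂ K c := by
    refine DifferentiableAt.div_const (DifferentiableAt.mul (DifferentiableAt.const_mul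
      (.mul ?_ ?_) _) (.mul ?_ ?_)) _
    · exact (hd _).comp c (by fun_prop)
    · exact (hd _).comp c (f := fun w => p / (c * w)) (by fun_prop (disch := assumption))
    · exact (hd _).comp c (f := fun w => c / w * p) (by fun_prop (disch := assumption))
    · exact (hd _).comp c (f := fun w => p / (c / w)) (by fun_prop (disch := assumption))
  have h0 : HasDerivAt (fun w : ℂ => 1 - c / w) (1 / c) c := by
    have := ((hasDerivAt_inv hc).const_mul c).const_sub 1
    simp only [← div_eq_mul_inv] at this
    refine this.congr_deriv ?_
    field_simp
  rw [hfun]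
  refine (h0.mul hKd.hasDerivAt).congr_deriv ?_
  simp only [hK, div_self hc, sub_self, zero_mul, add_zero, one_mul, div_one, thetaProd, pow_two]
  field_simp

/-- The four-term addition formula for the logarithmic derivative of theta, obtained by
differentiating the three-term relation. -/
theorem thetaPairLogDeriv_sub {p a b c : ℂ} (hp : ‖p‖ < 1) (hp0 : p ≠ 0) (hc : c ≠ 0)
    (ha1 : ‖a * c‖ < 1) (ha2 : ‖p / a / c‖ < 1) (ha3 : ‖a / c‖ < 1) (ha4 : ‖p / a * c‖ < 1)
    (hb1 : ‖b * c‖ < 1) (hb2 : ‖p / b / c‖ < 1) (hb3 : ‖b / c‖ < 1) (hb4 : ‖p / b * c‖ < 1)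
    (ha : a ≠ 0) (hb : b ≠ 0) :
    (thetaPairLogDeriv p a c - thetaPairLogDeriv p b c)
        * (thetaBracket p a c * thetaBracket p b c)
      = -(qPoch p p ^ 4 * thetaProd p (c ^ 2) / c * thetaBracket p a b) := by
  have hL := ((hasDerivAt_thetaBracket hp hc ha1 ha2 ha3 ha4).mul_const
    (thetaBracket p b c)).sub ((hasDerivAt_thetaBracket hp hc hb1 hb2 hb3 hb4).mul_const
    (thetaBracket p a c))
  have hR := ((hasDerivAt_thetaBracket_diag hp hc).mul_const (thetaBracket p a b)).neg
  have heq : (fun w => thetaBracket p a w * thetaBracket p b c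
      - thetaBracket p b w * thetaBracket p a c) =ᶠ[𝓝 c]
      fun w => -(thetaBracket p c w * thetaBracket p a b) := by
    filter_upwards [isOpen_ne.mem_nhds hc] with w hw
    exact thetaBracket_plucker hp hp0 ha hb hc hw
  have := (hL.congr_of_eventuallyEq heq.symm).unique hR
  field_simp at this ⊢
  linear_combination this

/-! ### Lambert series as theta quotients -/

theorem thetaProd_ne_zero {p z : ℂ} (hp : ‖p‖ < 1) (hz : ‖z‖ < 1) (hpz : ‖p / z‖ < 1) :
    thetaProd p z ≠ 0 :=
  mul_ne_zero (qPoch_ne_zero hp hz) (qPoch_ne_zero hp hpz)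

theorem thetaProd_eq_one_sub_mul {p z : ℂ} (hp : ‖p‖ < 1) :
    thetaProd p z = (1 - z) * (qPoch (p * z) p * qPoch (p / z) p) := by
  rw [thetaProd, qPoch_eq_mul_qPoch_mul z hp, mul_comm z p, mul_assoc]

theorem thetaProd_inv {p z : ℂ} (hp : ‖p‖ < 1) (hz : z ≠ 0) :
    thetaProd p z⁻¹ = -(z⁻¹ * thetaProd p z) := by
  rw [thetaProd_eq_one_sub_mul hp, thetaProd_eq_one_sub_mul hp, div_inv_eq_mul,
    ← div_eq_mul_inv]
  field_simp
  ring

/-- The coefficients `(aᵐ + (p/a)ᵐ - bᵐ - (p/b)ᵐ) / (1 - pᵐ)`, with `m` shifted by one. -/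
noncomputable def lambertCoeff (p a b : ℂ) (m : ℕ) : ℂ :=
  (a ^ (m + 1) + (p / a) ^ (m + 1) - b ^ (m + 1) - (p / b) ^ (m + 1)) / (1 - p ^ (m + 1))

/-- `(cⁿ - c⁻ⁿ) / (c - c⁻¹)` for `n = m + 1`, written without division so that it makes sense
at `c = 1`; for `c = exp(it)` this is `sin(nt) / sin t`. -/
noncomputable def sineRatio (c : ℂ) (m : ℕ) : ℂ :=
  c⁻¹ ^ m * ∑ j ∈ Finset.range (m + 1), (c ^ 2) ^ j

theorem sineRatio_mul {c : ℂ} (hc : c ≠ 0) (m : ℕ) :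
    sineRatio c m * (c - c⁻¹) = c ^ (m + 1) - c⁻¹ ^ (m + 1) := by
  have h := geom_sum_mul (c ^ 2) (m + 1)
  rw [sineRatio]
  have h1 : c - c⁻¹ = c⁻¹ * (c ^ 2 - 1) := by field_simp
  have h2 : c⁻¹ ^ m * c⁻¹ * (c ^ 2) ^ (m + 1) = c ^ (m + 1) := by
    rw [← pow_succ, ← mul_pow]; congr 1; field_simp
  rw [h1, pow_succ c⁻¹ m]
  linear_combination c⁻¹ ^ m * c⁻¹ * h + h2

theorem norm_sineRatio_le {c : ℂ} (hc : ‖c‖ = 1) (m : ℕ) : ‖sineRatio c m‖ ≤ m + 1 := by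
  rw [sineRatio, norm_mul, norm_pow, norm_inv, hc, inv_one, one_pow, one_mul]
  refine (norm_sum_le _ _).trans ?_
  simp [hc]

/-- The theta quotient summing the series of `sineRatio c m * lambertCoeff p a b m`. -/
noncomputable def thetaQuotient (p a b c : ℂ) : ℂ :=
  a * qPoch p p ^ 2 * (qPoch (p * c ^ 2) p * qPoch (p / c ^ 2) p) * thetaProd p (a * b)
    * thetaProd p (b / a)
    / (thetaProd p (a * c) * thetaProd p (a / c) * (thetaProd p (b * c) * thetaProd p (b / c)))

section

variable {p a b c : ℂ}

theorem hasSum_thetaPairLogDeriv (hp : ‖p‖ < 1)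
    (h1 : ‖a * c‖ < 1) (h2 : ‖p / a / c‖ < 1) (h3 : ‖a / c‖ < 1) (h4 : ‖p / a * c‖ < 1) :
    HasSum (fun m : ℕ => (c ^ (m + 1) - c⁻¹ ^ (m + 1))
      * ((a ^ (m + 1) + (p / a) ^ (m + 1)) / (1 - p ^ (m + 1)))) (-thetaPairLogDeriv p a c) := by
  have h := ((((summable_lambertSum hp h1).hasSum.neg).add
    (summable_lambertSum hp h2).hasSum).add (summable_lambertSum hp h3).hasSum).sub
    (summable_lambertSum hp h4).hasSum
  refine h.neg.congr_fun fun m => ?_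
  simp only [div_eq_mul_inv, mul_pow]
  ring

theorem norm_theta_args_lt_one (hp0 : p ≠ 0) (ha : ‖a‖ < 1) (hpa : ‖p‖ < ‖a‖) (hc : ‖c‖ = 1) :
    a ≠ 0 ∧ ‖a * c‖ < 1 ∧ ‖p / a / c‖ < 1 ∧ ‖a / c‖ < 1 ∧ ‖p / a * c‖ < 1 := by
  have ha0 : 0 < ‖a‖ := (norm_pos_iff.mpr hp0).trans hpa
  simp only [norm_mul, norm_div, hc, mul_one, div_one]
  exact ⟨norm_pos_iff.mp ha0, ha, (div_lt_one ha0).mpr hpa, ha, (div_lt_one ha0).mpr hpa⟩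

theorem thetaProd_pair_ne_zero (hp : ‖p‖ < 1) (hp0 : p ≠ 0) (ha : ‖a‖ < 1) (hpa : ‖p‖ < ‖a‖)
    (hc : ‖c‖ = 1) : thetaProd p (a * c) ≠ 0 ∧ thetaProd p (a / c) ≠ 0 := by
  obtain ⟨-, h1, h2, h3, h4⟩ := norm_theta_args_lt_one hp0 ha hpa hc
  exact ⟨thetaProd_ne_zero hp h1 (by rwa [← div_div]),
    thetaProd_ne_zero hp h3 (by rwa [div_div_eq_mul_div, ← div_mul_eq_mul_div])⟩

/-- The series over `m` of `sin(mt) / sin t` times the Lambert coefficients is a theta quotient. -/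
theorem hasSum_sineRatio_mul_lambertCoeff (hp : ‖p‖ < 1) (hp0 : p ≠ 0)
    (ha : ‖a‖ < 1) (hpa : ‖p‖ < ‖a‖) (hb : ‖b‖ < 1) (hpb : ‖p‖ < ‖b‖)
    (hc : ‖c‖ = 1) (hc2 : c ^ 2 ≠ 1) :
    HasSum (fun m => sineRatio c m * lambertCoeff p a b m) (thetaQuotient p a b c) := by
  have hc0 : c ≠ 0 := norm_ne_zero_iff.mp (by simp [hc])
  obtain ⟨ha0, a1, a2, a3, a4⟩ := norm_theta_args_lt_one hp0 ha hpa hc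
  obtain ⟨hb0, b1, b2, b3, b4⟩ := norm_theta_args_lt_one hp0 hb hpb hc
  obtain ⟨ta1, ta2⟩ := thetaProd_pair_ne_zero hp hp0 ha hpa hc
  obtain ⟨tb1, tb2⟩ := thetaProd_pair_ne_zero hp hp0 hb hpb hc
  have hP := qPoch_ne_zero hp hp
  have hcc : c - c⁻¹ ≠ 0 := by
    intro h
    apply hc2
    field_simp at h
    linear_combination h
  have hadd := thetaPairLogDeriv_sub hp hp0 hc0 a1 a2 a3 a4 b1 b2 b3 b4 ha0 hb0
  have hval : thetaPairLogDeriv p b c - thetaPairLogDeriv p a c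
      = (c - c⁻¹) * thetaQuotient p a b c := by
    have hab : thetaProd p (a / b) = -(a / b * thetaProd p (b / a)) := by
      have := thetaProd_inv hp (div_ne_zero hb0 ha0)
      rwa [inv_div] at this
    have hcsq : thetaProd p (c ^ 2) / c
        = -(c - c⁻¹) * (qPoch (p * c ^ 2) p * qPoch (p / c ^ 2) p) := by
      rw [thetaProd_eq_one_sub_mul hp]
      field_simp
      ring
    have hne : thetaBracket p a c * thetaBracket p b c ≠ 0 := by
      simp only [thetaBracket]
      positivity
    refine mul_right_cancel₀ hne ?_
    rw [mul_div_assoc, hcsq, thetaBracket.eq_def p a b, hab] at hadd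
    rw [← neg_sub, neg_mul, hadd, thetaQuotient, thetaBracket, thetaBracket]
    generalize thetaProd p (a * c) = A₁ at ta1 ⊢
    generalize thetaProd p (a / c) = A₂ at ta2 ⊢
    generalize thetaProd p (b * c) = B₁ at tb1 ⊢
    generalize thetaProd p (b / c) = B₂ at tb2 ⊢
    field_simp
  have h := ((hasSum_thetaPairLogDeriv hp a1 a2 a3 a4).sub
    (hasSum_thetaPairLogDeriv hp b1 b2 b3 b4)).div_const (c - c⁻¹)
  rw [show -thetaPairLogDeriv p a c - -thetaPairLogDeriv p b c
    = (c - c⁻¹) * thetaQuotient p a b c by rw [← hval]; ring, mul_div_cancel_left₀ _ hcc] at h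
  refine h.congr_fun fun m => ?_
  rw [← sineRatio_mul hc0, lambertCoeff]
  field_simp
  ring

theorem summable_mul_norm_lambertCoeff (hp : ‖p‖ < 1)
    (ha : ‖a‖ < 1) (hpa : ‖p‖ < ‖a‖) (hb : ‖b‖ < 1) (hpb : ‖p‖ < ‖b‖) :
    Summable fun m : ℕ => ((m : ℝ) + 1) * ‖lambertCoeff p a b m‖ := by
  have hs : ∀ z : ℂ, ‖z‖ < 1 → Summable fun m : ℕ => ((m : ℝ) + 1) * ‖z‖ ^ (m + 1) := by
    intro z hz
    have := (summable_nat_add_iff 1).mpr (summable_pow_mul_geometric_of_norm_lt_one 1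
      (r := ‖z‖) (by simpa using hz))
    simpa using this
  have ha' : ‖p / a‖ < 1 := by
    rw [norm_div]; exact (div_lt_one ((norm_nonneg p).trans_lt hpa)).mpr hpa
  have hb' : ‖p / b‖ < 1 := by
    rw [norm_div]; exact (div_lt_one ((norm_nonneg p).trans_lt hpb)).mpr hpb
  refine Summable.of_nonneg_of_le (fun m => by positivity) (fun m => ?_)
    (((((hs a ha).add (hs _ ha')).add (hs b hb)).add (hs _ hb')).mul_right (1 - ‖p‖)⁻¹)
  rw [lambertCoeff, div_eq_mul_inv, norm_mul, ← mul_assoc]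
  have h0 := norm_inv_one_sub_pow_le hp m
  refine mul_le_mul ?_ h0 (norm_nonneg _) (by positivity)
  rw [← mul_add, ← mul_add, ← mul_add]
  gcongr
  refine (norm_sub_le _ _).trans ?_
  rw [← norm_pow, ← norm_pow, ← norm_pow, ← norm_pow]
  gcongr
  refine (norm_sub_le _ _).trans ?_
  gcongr
  exact norm_add_le _ _

theorem ContinuousAt.qPoch {f : ℂ → ℂ} {z : ℂ} (hf : ContinuousAt f z) (hp : ‖p‖ < 1) :
    ContinuousAt (fun w => qPoch (f w) p) z :=
  (continuous_qPoch hp).continuousAt.comp hf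

theorem continuousAt_thetaQuotient_one (hp : ‖p‖ < 1) (hp0 : p ≠ 0)
    (ha : ‖a‖ < 1) (hpa : ‖p‖ < ‖a‖) (hb : ‖b‖ < 1) (hpb : ‖p‖ < ‖b‖) :
    ContinuousAt (thetaQuotient p a b) 1 := by
  have h1 : ‖(1 : ℂ)‖ = 1 := norm_one
  obtain ⟨ta1, ta2⟩ := thetaProd_pair_ne_zero hp hp0 ha hpa h1
  obtain ⟨tb1, tb2⟩ := thetaProd_pair_ne_zero hp hp0 hb hpb h1
  obtain ⟨ha0, -⟩ := norm_theta_args_lt_one hp0 ha hpa h1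
  obtain ⟨hb0, -⟩ := norm_theta_args_lt_one hp0 hb hpb h1
  have hθ : ∀ x : ℂ, x ≠ 0 → ContinuousAt (fun c => thetaProd p (x * c)) 1 ∧
      ContinuousAt (fun c => thetaProd p (x / c)) 1 := fun x hx => by
    refine ⟨.mul (.qPoch (by fun_prop) hp) (.qPoch ?_ hp),
      .mul (.qPoch ?_ hp) (.qPoch ?_ hp)⟩
    · exact continuousAt_const.div (by fun_prop) (by simpa)
    · exact continuousAt_const.div continuousAt_id one_ne_zero
    · exact continuousAt_const.div (continuousAt_const.div continuousAt_id one_ne_zero)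
        (by simpa)
  unfold thetaQuotient
  refine ContinuousAt.div ?_ (((hθ a ha0).1.mul (hθ a ha0).2).mul ((hθ b hb0).1.mul (hθ b hb0).2))
    (mul_ne_zero (mul_ne_zero ta1 ta2) (mul_ne_zero tb1 tb2))
  refine ((continuousAt_const.mul (.mul (.qPoch (by fun_prop) hp) (.qPoch ?_ hp))).mul
    continuousAt_const).mul continuousAt_const
  exact continuousAt_const.div (by fun_prop) (by simp)

/-- The limiting case `c → 1` along the unit circle. -/
theorem hasSum_mul_lambertCoeff (hp : ‖p‖ < 1) (hp0 : p ≠ 0)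
    (ha : ‖a‖ < 1) (hpa : ‖p‖ < ‖a‖) (hb : ‖b‖ < 1) (hpb : ‖p‖ < ‖b‖) :
    HasSum (fun m : ℕ => ((m : ℂ) + 1) * lambertCoeff p a b m) (thetaQuotient p a b 1) := by
  have hs := summable_mul_norm_lambertCoeff hp ha hpa hb hpb
  let e : ℝ → ℂ := fun t => Complex.exp (t * Complex.I)
  have he : Tendsto e (𝓝[>] 0) (𝓝 1) := by
    have : Continuous e := by fun_prop
    simpa [e] using (this.tendsto 0).mono_left nhdsWithin_le_nhds
  have hnorm : ∀ t, ‖e t‖ = 1 := Complex.norm_exp_ofReal_mul_I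
  have hlim := tendsto_tsum_of_dominated_convergence (𝓕 := 𝓝[>] (0 : ℝ))
    (f := fun t m => sineRatio (e t) m * lambertCoeff p a b m)
    (g := fun m : ℕ => ((m : ℂ) + 1) * lambertCoeff p a b m) hs
    (fun m => by
      refine Tendsto.mul_const _ ?_
      have hcont : ContinuousAt (fun c => sineRatio c m) 1 := by
        unfold sineRatio
        refine ((continuousAt_inv₀ one_ne_zero).pow m).mul (by fun_prop)
      have := hcont.tendsto.comp he
      simpa [sineRatio, Function.comp_def] using this)
    (.of_forall fun t m => by
      rw [norm_mul]
      gcongr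
      exact norm_sineRatio_le (hnorm t) m)
  have hlim2 := (continuousAt_thetaQuotient_one hp hp0 ha hpa hb hpb).tendsto.comp he
  have hev : ∀ᶠ t in 𝓝[>] (0 : ℝ),
      ∑' m, sineRatio (e t) m * lambertCoeff p a b m = thetaQuotient p a b (e t) := by
    filter_upwards [Ioo_mem_nhdsGT Real.pi_pos] with t ht
    refine (hasSum_sineRatio_mul_lambertCoeff hp hp0 ha hpa hb hpb (hnorm t) ?_).tsum_eq
    intro h
    have him : (e t).im = Real.sin t := Complex.exp_ofReal_mul_I_im t
    have hpos := Real.sin_pos_of_pos_of_lt_pi ht.1 ht.2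
    rw [← him] at hpos
    have h' : (e t - 1) * (e t + 1) = 0 := by linear_combination h
    rcases mul_eq_zero.mp h' with h | h
    · rw [sub_eq_zero.mp h] at hpos; simp at hpos
    · rw [eq_neg_of_add_eq_zero_left h] at hpos; simp at hpos
  have := tendsto_nhds_unique (hlim.congr' hev) hlim2
  rw [← this]
  refine (Summable.of_norm ?_).hasSum
  refine hs.congr fun m => ?_
  rw [norm_mul]
  norm_cast

end

/-! ### Specialization to base `q⁸` and eta quotients -/

/-- Euler's function `∏_{n ≥ 1} (1 - xⁿ)`. -/
noncomputable def eulerProd (x : ℂ) : ℂ := qPoch x x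

theorem eulerProd_ne_zero {x : ℂ} (hx : ‖x‖ < 1) : eulerProd x ≠ 0 := qPoch_ne_zero hx hx

theorem qPoch_sq_mul_eulerProd {x : ℂ} (hx : ‖x‖ < 1) :
    qPoch x (x ^ 2) * eulerProd (x ^ 2) = eulerProd x := by
  rw [eulerProd, eulerProd, ← qPoch_sq_mul x hx, ← sq]

theorem qPoch_sq_eq_div {x : ℂ} (hx : ‖x‖ < 1) :
    qPoch x (x ^ 2) = eulerProd x / eulerProd (x ^ 2) :=
  eq_div_of_mul_eq (eulerProd_ne_zero (norm_pow_lt_one hx two_ne_zero)) (qPoch_sq_mul_eulerProd hx)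

theorem qPoch_neg_sq_eq_div {x : ℂ} (hx : ‖x‖ < 1) :
    qPoch (-x) (x ^ 2) = eulerProd (x ^ 2) ^ 2 / (eulerProd x * eulerProd (x ^ 4)) := by
  have hx2 := norm_pow_lt_one hx two_ne_zero
  have h := qPoch_mul_qPoch_neg x hx2
  rw [qPoch_sq_eq_div hx, qPoch_sq_eq_div hx2, ← pow_mul] at h
  have h1 := eulerProd_ne_zero hx
  have h2 := eulerProd_ne_zero hx2
  have h4 := eulerProd_ne_zero (norm_pow_lt_one hx (k := 4) (by norm_num))
  norm_num at h
  field_simp at h ⊢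
  linear_combination h

/-- `φ(x) = ∏ (1 - x^{2n})⁵ / ((1 - xⁿ)² (1 - x^{4n})²)`. -/
theorem ramanujanPhi_eq {x : ℂ} (hx : ‖x‖ < 1) (hx0 : x ≠ 0) :
    ramanujanPhi x = eulerProd (x ^ 2) ^ 5 / (eulerProd x ^ 2 * eulerProd (x ^ 4) ^ 2) := by
  have hsum : ramanujanPhi x = evenTheta x 1 := by
    rw [ramanujanPhi, ramanujanTheta, ← (hasSum_evenTheta hx hx0 one_ne_zero).tsum_eq]
    refine tsum_congr fun j => ?_
    rw [← zpow_add₀ hx0, one_zpow, mul_one]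
    congr 1
    have h1 := two_mul_choose_two j
    have h2 := two_mul_choose_two (j + 1)
    rw [add_sub_cancel_right, mul_comm (j + 1) j] at h2
    lia
  have h1 := eulerProd_ne_zero hx
  have h2 := eulerProd_ne_zero (norm_pow_lt_one hx (k := 2) (by norm_num))
  have h4 := eulerProd_ne_zero (norm_pow_lt_one hx (k := 4) (by norm_num))
  have hdiv : x ^ 2 / -x = -x := by field_simp
  rw [hsum, evenTheta, one_pow, mul_one, thetaProd, hdiv, qPoch_neg_sq_eq_div hx, ← eulerProd]
  field_simp

/-- `ψ(x) = ∏ (1 - x^{2n})² / (1 - xⁿ)`. -/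
theorem ramanujanPsi_eq {x : ℂ} (hx : ‖x‖ < 1) (hx0 : x ≠ 0) :
    ramanujanPsi x = eulerProd (x ^ 2) ^ 2 / eulerProd x := by
  have hx2 := norm_pow_lt_one hx two_ne_zero
  have hx4 := norm_pow_lt_one hx (k := 4) (by norm_num)
  have h22 : (x ^ 2) ^ 2 = x ^ 4 := by ring
  have hsum : ramanujanPsi x = qPoch (x ^ 4) (x ^ 4) * thetaProd (x ^ 4) (-x) := by
    rw [ramanujanPsi, ramanujanTheta,
      ← (hasSum_tripleTerm hx4 (pow_ne_zero 4 hx0) (neg_ne_zero.mpr hx0)).tsum_eq]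
    refine tsum_congr fun j => ?_
    rw [← h22, tripleTerm_sq_neg, ← zpow_natCast x 3, ← zpow_natCast x 2, ← zpow_mul, ← zpow_mul,
      ← zpow_add₀ hx0, ← zpow_add₀ hx0]
    congr 1
    have h1 := two_mul_choose_two j
    have h2 := two_mul_choose_two (j + 1)
    rw [add_sub_cancel_right, mul_comm (j + 1) j] at h2
    push_cast
    lia
  have h1 := eulerProd_ne_zero hx
  have h4 := eulerProd_ne_zero hx4
  have hdiv : x ^ 4 / -x = -x * x ^ 2 := by field_simp
  rw [hsum, thetaProd, hdiv, ← h22, qPoch_sq_mul _ hx2, qPoch_neg_sq_eq_div hx, ← eulerProd, h22]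
  field_simp

theorem thetaProd_pow_eight_four {q : ℂ} (hq : ‖q‖ < 1) :
    thetaProd (q ^ 8) (q ^ 4) = (eulerProd (q ^ 4) / eulerProd (q ^ 8)) ^ 2 := by
  have h := qPoch_sq_eq_div (norm_pow_lt_one hq (k := 4) (by norm_num))
  rw [← pow_mul] at h
  have hd : q ^ 8 / q ^ 4 = q ^ 4 := by
    rcases eq_or_ne q 0 with rfl | h0
    · simp
    · field_simp
  rw [thetaProd, hd, ← sq, ← h]

theorem thetaProd_pow_eight_two {q : ℂ} (hq : ‖q‖ < 1) (hq0 : q ≠ 0) :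
    thetaProd (q ^ 8) (q ^ 2) = eulerProd (q ^ 2) / eulerProd (q ^ 4) := by
  have h := qPoch_sq_eq_div (norm_pow_lt_one hq (k := 2) (by norm_num))
  have h2 := qPoch_sq_mul (q ^ 2) (norm_pow_lt_one hq (k := 4) (by norm_num))
  rw [← pow_mul] at h h2
  have hd : q ^ 8 / q ^ 2 = q ^ 2 * q ^ 4 := by field_simp
  rw [thetaProd, hd, h2, h]

theorem thetaProd_pow_eight_one_three {q : ℂ} (hq : ‖q‖ < 1) (hq0 : q ≠ 0) :
    thetaProd (q ^ 8) q * thetaProd (q ^ 8) (q ^ 3) = eulerProd q / eulerProd (q ^ 2) := by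
  have hq4 := norm_pow_lt_one hq (k := 4) (by norm_num)
  have h1 := qPoch_sq_mul q hq4
  have h3 := qPoch_sq_mul (q ^ 3) hq4
  have h13 := qPoch_sq_mul q (norm_pow_lt_one hq two_ne_zero)
  rw [show (q ^ 4) ^ 2 = q ^ 8 by ring] at h1 h3
  rw [show (q ^ 2) ^ 2 = q ^ 4 by ring, show q * q ^ 2 = q ^ 3 by ring, ← h1, ← h3] at h13
  have hd : q ^ 8 / q = q ^ 3 * q ^ 4 := by field_simp
  have hd3 : q ^ 8 / q ^ 3 = q * q ^ 4 := by field_simp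
  rw [← qPoch_sq_eq_div hq, ← h13, thetaProd, thetaProd, hd, hd3]
  ring

theorem thetaProd_mul_cube_roots {p ω a : ℂ} (hp : ‖p‖ < 1) (hω : 1 + ω + ω ^ 2 = 0) :
    thetaProd p a * (thetaProd p (a * ω) * thetaProd p (a / ω)) = thetaProd (p ^ 3) (a ^ 3) := by
  have h1 := qPoch_mul_cube_roots a hp hω
  have h2 := qPoch_mul_cube_roots (p / a) hp hω
  rw [div_pow] at h2
  rw [thetaProd, thetaProd, thetaProd, thetaProd, ← h1, ← h2, div_div_eq_mul_div, ← div_div p a ω,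
    mul_comm a ω, div_eq_inv_mul a ω, div_eq_inv_mul (p / a) ω, ← div_mul_eq_mul_div,
    mul_comm (p / a) ω]
  ring

/-- The theta quotient at `c = 1`, for `p = q⁸`, `a = q`, `b = q³`. -/
theorem thetaQuotient_one_eq {q : ℂ} (hq : ‖q‖ < 1) (hq0 : q ≠ 0) :
    thetaQuotient (q ^ 8) q (q ^ 3) 1
      = q * eulerProd (q ^ 8) ^ 2 * eulerProd (q ^ 4) * eulerProd (q ^ 2) ^ 3
        / eulerProd q ^ 2 := by
  have h1 := eulerProd_ne_zero hq
  have h2 := eulerProd_ne_zero (norm_pow_lt_one hq (k := 2) (by norm_num))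
  have h4 := eulerProd_ne_zero (norm_pow_lt_one hq (k := 4) (by norm_num))
  have h8 := eulerProd_ne_zero (norm_pow_lt_one hq (k := 8) (by norm_num))
  have hden : thetaProd (q ^ 8) q * thetaProd (q ^ 8) q
      * (thetaProd (q ^ 8) (q ^ 3) * thetaProd (q ^ 8) (q ^ 3))
      = (eulerProd q / eulerProd (q ^ 2)) ^ 2 := by
    rw [← thetaProd_pow_eight_one_three hq hq0]; ring
  have hd : q ^ 3 / q = q ^ 2 := by field_simp
  rw [thetaQuotient, one_pow, mul_one, mul_one, mul_one, div_one, div_one, div_one, hden, hd,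
    show q * q ^ 3 = q ^ 4 by ring, thetaProd_pow_eight_four hq, thetaProd_pow_eight_two hq hq0,
    ← eulerProd]
  field_simp

/-- The theta quotient at a primitive cube root of unity, for `p = q⁸`, `a = q`, `b = q³`. -/
theorem thetaQuotient_cube_root_eq {q ω : ℂ} (hq : ‖q‖ < 1) (hq0 : q ≠ 0)
    (hω : 1 + ω + ω ^ 2 = 0) :
    thetaQuotient (q ^ 8) q (q ^ 3) ω
      = q * eulerProd q * eulerProd (q ^ 4) * eulerProd (q ^ 6) * eulerProd (q ^ 24)
        / (eulerProd (q ^ 3) * eulerProd (q ^ 8)) := by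
  have hk : ∀ k : ℕ, k ≠ 0 → eulerProd (q ^ k) ≠ 0 := fun k h =>
    eulerProd_ne_zero (norm_pow_lt_one hq h)
  have h1 := eulerProd_ne_zero hq
  have h2 := hk 2 (by norm_num)
  have h3 := hk 3 (by norm_num)
  have h4 := hk 4 (by norm_num)
  have h6 := hk 6 (by norm_num)
  have h8 := hk 8 (by norm_num)
  have hp := norm_pow_lt_one hq (k := 8) (by norm_num)
  have hω0 : ω ≠ 0 := by rintro rfl; norm_num at hω
  have hω3 : ω ^ 3 = 1 := by linear_combination (ω - 1) * hω
  have hnum : qPoch (q ^ 8 * ω ^ 2) (q ^ 8) * qPoch (q ^ 8 / ω ^ 2) (q ^ 8)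
      = eulerProd (q ^ 24) / eulerProd (q ^ 8) := by
    have h := qPoch_mul_cube_roots (q ^ 8) hp hω
    rw [← pow_mul, ← eulerProd, ← eulerProd] at h
    have e1 : q ^ 8 * ω ^ 2 = ω⁻¹ * q ^ 8 := by
      field_simp
      linear_combination hω3
    have e2 : q ^ 8 / ω ^ 2 = ω * q ^ 8 := by
      field_simp
      linear_combination -hω3
    rw [e1, e2, eq_div_iff h8, ← h]
    ring
  have hden : thetaProd (q ^ 8) (q * ω) * thetaProd (q ^ 8) (q / ω)
      * (thetaProd (q ^ 8) (q ^ 3 * ω) * thetaProd (q ^ 8) (q ^ 3 / ω))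
      = (eulerProd (q ^ 3) / eulerProd (q ^ 6)) / (eulerProd q / eulerProd (q ^ 2)) := by
    have e1 := thetaProd_mul_cube_roots (a := q) hp hω
    have e3 := thetaProd_mul_cube_roots (a := q ^ 3) hp hω
    have e := thetaProd_pow_eight_one_three (norm_pow_lt_one hq (k := 3) (by norm_num))
      (pow_ne_zero 3 hq0)
    have e' := thetaProd_pow_eight_one_three hq hq0
    rw [show (q ^ 3) ^ 8 = (q ^ 8) ^ 3 by ring, ← e1, ← e3, ← pow_mul] at e
    norm_num at e
    rw [← e, ← e']
    have hne : thetaProd (q ^ 8) q * thetaProd (q ^ 8) (q ^ 3) ≠ 0 := by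
      rw [e']; exact div_ne_zero h1 h2
    rw [eq_div_iff hne]
    ring
  have hd : q ^ 3 / q = q ^ 2 := by field_simp
  rw [thetaQuotient, hden, hd, hnum, show q * q ^ 3 = q ^ 4 by ring, thetaProd_pow_eight_four hq,
    thetaProd_pow_eight_two hq hq0, ← eulerProd]
  field_simp

theorem lambertCoeff_pow_eight {q : ℂ} (hq0 : q ≠ 0) (m : ℕ) :
    lambertCoeff (q ^ 8) q (q ^ 3) m
      = (q ^ (m + 1) - q ^ (3 * (m + 1)) - q ^ (5 * (m + 1)) + q ^ (7 * (m + 1)))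
        / (1 - q ^ (8 * (m + 1))) := by
  have h1 : q ^ 8 / q = q ^ 7 := by field_simp
  have h3 : q ^ 8 / q ^ 3 = q ^ 5 := by field_simp
  rw [lambertCoeff, h1, h3]
  simp only [← pow_mul]
  ring

theorem sineRatio_cube_root {ω : ℂ} (hω : 1 + ω + ω ^ 2 = 0) (m : ℕ) :
    sineRatio ω m = (legendreSym 3 ((m + 1 : ℕ) : ℤ) : ℂ) := by
  have hω0 : ω ≠ 0 := by rintro rfl; norm_num at hω
  have hω3 : ω ^ 3 = 1 := by linear_combination (ω - 1) * hω
  have hinv : ω⁻¹ = ω ^ 2 := inv_eq_of_mul_eq_one_right (by rw [← hω3]; ring)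
  have hne : ω - ω⁻¹ ≠ 0 := by
    intro h
    rw [hinv] at h
    have h2 : ω * 2 = -1 := by linear_combination h + hω
    have h3 : (4 : ℂ) * (1 + ω + ω ^ 2) = 3 := by linear_combination (2 * ω + 1) * h2
    rw [hω] at h3
    norm_num at h3
  refine mul_right_cancel₀ hne ?_
  rw [sineRatio_mul hω0, hinv, legendreSym.mod]
  have hm := Nat.div_add_mod (m + 1) 3
  have hlt := Nat.mod_lt (m + 1) three_pos
  have hred : ∀ z : ℂ, z ^ 3 = 1 → z ^ (m + 1) = z ^ ((m + 1) % 3) := fun z hz => by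
    conv_lhs => rw [← hm, pow_add, pow_mul, hz, one_pow, one_mul]
  rw [hred ω hω3, hred (ω ^ 2) (by rw [← pow_mul, mul_comm, pow_mul, hω3, one_pow]),
    show ((m + 1 : ℕ) : ℤ) % ((3 : ℕ) : ℤ) = (((m + 1) % 3 : ℕ) : ℤ) by push_cast; rfl]
  interval_cases (m + 1) % 3
  · simp
  · simp
  · have : legendreSym 3 ((2 : ℕ) : ℤ) = -1 := by decide
    rw [this]
    push_cast
    linear_combination -ω * hω3

theorem eta_mul_eq (τ : ℂ) (k : ℕ) :
    ModularForm.eta (k * τ) = Complex.exp (2 * Real.pi * Complex.I * τ / 24) ^ k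
      * eulerProd (Complex.exp (2 * Real.pi * Complex.I * τ) ^ k) := by
  rw [ModularForm.eta, eulerProd, qPoch]
  congr 1
  · rw [Function.Periodic.qParam, ← Complex.exp_nat_mul]
    congr 1
    push_cast
    ring
  · refine tprod_congr fun n => ?_
    have h : Complex.exp (2 * Real.pi * Complex.I * (k * τ))
        = Complex.exp (2 * Real.pi * Complex.I * τ) ^ k := by
      rw [← Complex.exp_nat_mul]
      congr 1
      ring
    rw [ModularForm.eta_q_eq_pow, h, pow_succ']

theorem theorem4p4 (τ q : ℂ) (hτ : 0 < τ.im)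
    (hq : q = Complex.exp (2 * Real.pi * Complex.I * τ)) :
    HasSum
      (fun m : ℕ+ =>
        (m : ℂ) * (q ^ (m : ℕ) - q ^ (3 * (m : ℕ)) - q ^ (5 * (m : ℕ)) + q ^ (7 * (m : ℕ)))
          / (1 - q ^ (8 * (m : ℕ))))
      (ModularForm.eta (8 * τ) ^ 4 * ModularForm.eta (4 * τ) ^ 2 / ModularForm.eta (2 * τ) ^ 2
        * (ramanujanPhi q / (Complex.exp (Real.pi * Complex.I * τ) * ramanujanPsi (q ^ 4)))) ∧
    HasSum
      (fun m : ℕ+ =>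
        (legendreSym 3 ((m : ℕ) : ℤ) : ℂ)
          * ((q ^ (m : ℕ) - q ^ (3 * (m : ℕ)) - q ^ (5 * (m : ℕ)) + q ^ (7 * (m : ℕ)))
          / (1 - q ^ (8 * (m : ℕ)))))
      (ModularForm.eta τ * ModularForm.eta (2 * τ) ^ 2 * ModularForm.eta (6 * τ)
          * ModularForm.eta (8 * τ) ^ 3 * ModularForm.eta (24 * τ)
          / (ModularForm.eta (3 * τ) * ModularForm.eta (4 * τ) ^ 5)
        * (ramanujanPhi (q ^ 2)
          / (Complex.exp (Real.pi * Complex.I * τ) * ramanujanPsi (q ^ 4)))) := by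
  have hq1 : ‖q‖ < 1 := by
    rw [hq]
    exact UpperHalfPlane.norm_exp_two_pi_I_lt_one ⟨τ, hτ⟩
  have hq0 : q ≠ 0 := hq ▸ Complex.exp_ne_zero _
  have hk : ∀ k : ℕ, k ≠ 0 → eulerProd (q ^ k) ≠ 0 := fun k h =>
    eulerProd_ne_zero (norm_pow_lt_one hq1 h)
  have h1 := eulerProd_ne_zero hq1
  have h2 := hk 2 (by norm_num)
  have h3 := hk 3 (by norm_num)
  have h4 := hk 4 (by norm_num)
  have h6 := hk 6 (by norm_num)
  have h8 := hk 8 (by norm_num)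
  -- Everything is a power of `e^{2πiτ/24}` times a product of Euler functions.
  set h : ℂ := Complex.exp (2 * Real.pi * Complex.I * τ / 24) with hh
  have hh0 : h ≠ 0 := Complex.exp_ne_zero _
  have hqh : q = h ^ 24 := by
    rw [hq, hh, ← Complex.exp_nat_mul]
    congr 1
    push_cast
    ring
  have hqh2 : Complex.exp (Real.pi * Complex.I * τ) = h ^ 12 := by
    rw [hh, ← Complex.exp_nat_mul]
    congr 1
    push_cast
    ring
  have heta : ∀ k : ℕ, ModularForm.eta (k * τ) = h ^ k * eulerProd (q ^ k) := fun k => by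
    rw [eta_mul_eq, ← hq]
  have e1 := heta 1
  have e2 := heta 2
  have e3 := heta 3
  have e4 := heta 4
  have e6 := heta 6
  have e8 := heta 8
  have e24 := heta 24
  push_cast at e1 e2 e3 e4 e6 e8 e24
  rw [one_mul, pow_one, pow_one] at e1
  have hphi := ramanujanPhi_eq hq1 hq0
  have hphi2 := ramanujanPhi_eq (norm_pow_lt_one hq1 two_ne_zero) (pow_ne_zero 2 hq0)
  have hpsi := ramanujanPsi_eq (norm_pow_lt_one hq1 four_ne_zero) (pow_ne_zero 4 hq0)
  simp only [← pow_mul, Nat.reduceMul] at hphi2 hpsi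
  have hp := norm_pow_lt_one hq1 (k := 8) (by norm_num)
  have hp0 : q ^ 8 ≠ 0 := pow_ne_zero 8 hq0
  have hb := norm_pow_lt_one hq1 (k := 3) (by norm_num)
  have hlt : ∀ j k : ℕ, j < k → ‖q ^ k‖ < ‖q ^ j‖ := fun j k hjk => by
    rw [norm_pow, norm_pow]
    exact pow_lt_pow_right_of_lt_one₀ (norm_pos_iff.mpr hq0) hq1 hjk
  have hpa : ‖q ^ 8‖ < ‖q‖ := by simpa using hlt 1 8 (by norm_num)
  have hpb := hlt 3 8 (by norm_num)
  have hpred : ∀ m : ℕ+, m.natPred + 1 = (m : ℕ) := PNat.natPred_add_one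
  constructor
  -- Sum formula for `c → 1`, with the summation index shifted from `ℕ` to `ℕ+`.
  · have hs := Equiv.pnatEquivNat.hasSum_iff.mpr
      (hasSum_mul_lambertCoeff hp hp0 hq1 hpa hb hpb)
    rw [thetaQuotient_one_eq hq1 hq0] at hs
    convert hs using 1
    · funext m
      simp only [Function.comp_apply, Equiv.pnatEquivNat_apply, lambertCoeff_pow_eight hq0, hpred]
      rw [← Nat.cast_add_one, hpred, mul_div_assoc]
    · rw [e8, e4, e2, hqh2, hphi, hpsi]
      field_simp
      exact hqh.symm
  -- Sum formula at a primitive cube root of unity, where `sineRatio` is the Legendre symbol.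
  · obtain ⟨ω, hω⟩ : ∃ ω : ℂ, IsPrimitiveRoot ω 3 :=
      ⟨_, Complex.isPrimitiveRoot_exp 3 three_ne_zero⟩
    have hω1 : ‖ω‖ = 1 := hω.norm'_eq_one three_ne_zero
    have hω0 : 1 + ω + ω ^ 2 = 0 := by
      have := hω.geom_sum_eq_zero (by norm_num)
      simpa [Finset.sum_range_succ] using this
    have hω2 : ω ^ 2 ≠ 1 := hω.pow_ne_one_of_pos_of_lt two_ne_zero (by norm_num)
    have hs := Equiv.pnatEquivNat.hasSum_iff.mpr
      (hasSum_sineRatio_mul_lambertCoeff hp hp0 hq1 hpa hb hpb hω1 hω2)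
    rw [thetaQuotient_cube_root_eq hq1 hq0 hω0] at hs
    convert hs using 1
    · funext m
      simp only [Function.comp_apply, Equiv.pnatEquivNat_apply, lambertCoeff_pow_eight hq0,
        sineRatio_cube_root hω0, hpred]
    · rw [e24, e8, e6, e4, e3, e2, e1, hqh2, hphi2, hpsi]
      field_simp
      rw [← hqh]
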